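/- \textbf{Model (general Gaussian Y-channel).} Three users $1,2,3$ communicate only through a relay. Fix real channel coefficients $h_1,h_2,h_3$ and power constraints $P$ (each user) and $P_r$ (relay). Let $\vec R=(R_{jk})_{j\ne k}$ be a tuple of six nonnegative rates. An $(\vec R,n)$ code has, for every ordered pair of distinct users $j,k$, a message $m_{jk}$ from user $j$ to user $k$ in $\{1,\dots,\lfloor 2^{nR_{jk}}\rfloor\}$, and consists of measurable encoding and decoding functions as follows, where $\{j,k,l\}=\{1,2,3\}$. At each time $i=1,\dots,n$, user $j$ sends the real symbol $X_{ji}=f_{j,i}(m_{jk},m_{jl},Y_j^{i-1})$ and the relay sends the real symbol $X_{ri}=f_{r,i}(Y_r^{i-1})$, where $Y^{i-1}=(Y_1,\dots,Y_{i-1})$ are the symbols previously received at that node. The received symbols are $$Y_{ri}=h_1X_{1i}+h_2X_{2i}+h_3X_{3i}+Z_{ri},\qquad Y_{ji}=h_jX_{ri}+Z_{ji}\quad(j=1,2,3),$$ where all noise samples $Z_{ri},Z_{ji}$ are independent $\mathcal N(0,1)$ and independent of the messages, which are independent and uniformly distributed. The power constraints are $\frac1n\sum_{i=1}^n\mathbb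 E[X_{ji}^2]\le P$ for $j=1,2,3$ and $\frac1n\sum_{i=1}^n\mathbb E[X_{ri}^2]\le P_r$. User $j$ forms estimates $(\hat m_{kj},\hat m_{lj})=g_j(Y_j^n,m_{jk},m_{jl})$, and an error occurs if for some user $j$ these differ from $(m_{kj},m_{lj})$. The tuple $\vec R\in\mathbb R_+^6$ is achievable if there is a sequence of $(\vec R,n)$ codes satisfying the power constraints whose average error probability tends to $0$ as $n\to\infty$. \textbf{Lemma.} Let $C(x)=\tfrac12\log_2(1+x)$. If $\vec R$ is achievable, then for all distinct $j,k,l\in\{1,2,3\}$ $$R_{kj}+R_{lj}+R_{kl}\le C\bigl(h_j^2P_r+h_l^2P_r\bigr).$$ -/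

import Mathlib

namespace YChannel

open MeasureTheory

/-- A rate tuple: `R j k` (with `k ≠ j`) is the rate `R_{jk}` of the message from user `j` to
user `k`, in bits per channel use. -/
abbrev Rates : Type := (j : Fin 3) → {k : Fin 3 // k ≠ j} → ℝ

/-- The message set `{1, …, 2^{nR}}`, i.e. the positive integers up to `2^{nR}`
(numbered from `0`). -/
abbrev MessageSet (n : ℕ) (r : ℝ) : Type := Fin ⌊(2 : ℝ) ^ ((n : ℝ) * r)⌋₊

/-- The two messages of user `j`, one for each of the other users. -/
abbrev OwnMessages (n : ℕ) (R : Rates) (j : Fin 3) : Type :=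
  (k : {k : Fin 3 // k ≠ j}) → MessageSet n (R j k)

/-- The two messages intended for user `j`, one from each of the other users. -/
abbrev WantedMessages (n : ℕ) (R : Rates) (j : Fin 3) : Type :=
  (k : {k : Fin 3 // k ≠ j}) → MessageSet n (R k ⟨j, k.2.symm⟩)

/-- All six messages. -/
abbrev Messages (n : ℕ) (R : Rates) : Type := (j : Fin 3) → OwnMessages n R j

/-- The messages intended for user `j` within the tuple of all messages. -/
def wanted {n : ℕ} {R : Rates} (m : Messages n R) (j : Fin 3) : WantedMessages n R j :=
  fun k => m k ⟨j, k.2.symm⟩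

/-- An `(R, n)` code for the general Y-channel. Times are numbered from `0` to `n - 1`, so that
at time `i` a node has previously received the `i` symbols with indices `t : Fin i`. -/
structure Code (n : ℕ) (R : Rates) where
  /-- encoder of user `j` at time `i` -/
  enc : (j : Fin 3) → (i : Fin n) → OwnMessages n R j × (Fin i → ℝ) → ℝ
  /-- encoder of the relay at time `i` -/
  relayEnc : (i : Fin n) → (Fin i → ℝ) → ℝ
  /-- decoder of user `j` -/
  dec : (j : Fin 3) → (Fin n → ℝ) × OwnMessages n R j → WantedMessages n R j
  measurable_enc : ∀ j i, Measurable (enc j i)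
  measurable_relayEnc : ∀ i, Measurable (relayEnc i)
  measurable_dec : ∀ j, Measurable (dec j)

/-- The sample space: the messages, the noise `Z_j` at the users, the noise `Z_r` at the relay. -/
abbrev Sample (n : ℕ) (R : Rates) : Type :=
  Messages n R × (Fin 3 → Fin n → ℝ) × (Fin n → ℝ)

/-- The messages are independent and uniformly distributed; all noise samples are independent
standard Gaussian, and independent of the messages. -/
noncomputable def law (n : ℕ) (R : Rates) : Measure (Sample n R) :=
  (ProbabilityTheory.uniformOn (Set.univ : Set (Messages n R))).prod
    ((Measure.pi fun _ : Fin 3 => Measure.pi fun _ : Fin n =>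
        ProbabilityTheory.gaussianReal 0 1).prod
      (Measure.pi fun _ : Fin n => ProbabilityTheory.gaussianReal 0 1))

/-- The symbols received at time `i`, by the users (first component) and by the relay (second
component), when the code `c` is used over the channel with coefficients `h`. -/
noncomputable def received {n : ℕ} {R : Rates} (h : Fin 3 → ℝ) (c : Code n R) (ω : Sample n R)
    (i : Fin n) : (Fin 3 → ℝ) × ℝ :=
  let past : Fin i → (Fin 3 → ℝ) × ℝ := fun t => received h c ω ⟨t, t.2.trans i.2⟩
  (fun j => h j * c.relayEnc i (fun t => (past t).2) + ω.2.1 j i,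
    ∑ j, h j * c.enc j i (ω.1 j, fun t => (past t).1 j) + ω.2.2 i)
termination_by i.val

/-- The symbol `Y_{ji}` received by user `j` at time `i`. -/
noncomputable def userOutput {n : ℕ} {R : Rates} (h : Fin 3 → ℝ) (c : Code n R) (j : Fin 3)
    (i : Fin n) (ω : Sample n R) : ℝ :=
  (received h c ω i).1 j

/-- The symbol `Y_{ri}` received by the relay at time `i`. -/
noncomputable def relayOutput {n : ℕ} {R : Rates} (h : Fin 3 → ℝ) (c : Code n R)
    (i : Fin n) (ω : Sample n R) : ℝ :=
  (received h c ω i).2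

/-- The symbol `X_{ji} = f_j(m_{jk}, m_{jl}, Y_j^{i-1})` sent by user `j` at time `i`. -/
noncomputable def userInput {n : ℕ} {R : Rates} (h : Fin 3 → ℝ) (c : Code n R) (j : Fin 3)
    (i : Fin n) (ω : Sample n R) : ℝ :=
  c.enc j i (ω.1 j, fun t => userOutput h c j ⟨t, t.2.trans i.2⟩ ω)

/-- The symbol `X_{ri} = f_r(Y_r^{i-1})` sent by the relay at time `i`. -/
noncomputable def relayInput {n : ℕ} {R : Rates} (h : Fin 3 → ℝ) (c : Code n R)
    (i : Fin n) (ω : Sample n R) : ℝ :=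
  c.relayEnc i (fun t => relayOutput h c ⟨t, t.2.trans i.2⟩ ω)

/-- The downlink equation `Y_{ji} = h_j X_{ri} + Z_{ji}`. -/
theorem userOutput_eq {n : ℕ} {R : Rates} (h : Fin 3 → ℝ) (c : Code n R) (j : Fin 3)
    (i : Fin n) (ω : Sample n R) :
    userOutput h c j i ω = h j * relayInput h c i ω + ω.2.1 j i := by
  unfold userOutput relayInput relayOutput
  rw [received]

/-- The uplink equation `Y_{ri} = h_1 X_{1i} + h_2 X_{2i} + h_3 X_{3i} + Z_{ri}`. -/
theorem relayOutput_eq {n : ℕ} {R : Rates} (h : Fin 3 → ℝ) (c : Code n R)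
    (i : Fin n) (ω : Sample n R) :
    relayOutput h c i ω = ∑ j, h j * userInput h c j i ω + ω.2.2 i := by
  unfold relayOutput userInput userOutput
  rw [received]

/-- The average power constraint `(1/n) ∑_i E[X_i²] ≤ P` (with finite second moments). -/
def PowerConstraint {n : ℕ} {R : Rates} (X : Fin n → Sample n R → ℝ) (P : ℝ) : Prop :=
  (∀ i, Integrable (fun ω => X i ω ^ 2) (law n R)) ∧
    (1 / (n : ℝ)) * ∑ i, ∫ ω, X i ω ^ 2 ∂(law n R) ≤ P

/-- All users meet the power constraint `P`, and the relay meets the power constraint `Pr`. -/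
def Code.Admissible {n : ℕ} {R : Rates} (h : Fin 3 → ℝ) (P Pr : ℝ) (c : Code n R) : Prop :=
  (∀ j, PowerConstraint (userInput h c j) P) ∧ PowerConstraint (relayInput h c) Pr

/-- The average error probability: the probability that some user decodes at least one of its
two wanted messages incorrectly. -/
noncomputable def Code.errorProb {n : ℕ} {R : Rates} (h : Fin 3 → ℝ) (c : Code n R) : ENNReal :=
  law n R {ω | ∃ j, c.dec j (fun i => userOutput h c j i ω, ω.1 j) ≠ wanted ω.1 j}

/-- The capacity region: the nonnegative rate tuples for which there are admissible codes of all
block lengths whose average error probability tends to zero. -/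
def capacityRegion (h : Fin 3 → ℝ) (P Pr : ℝ) : Set Rates :=
  {R | (∀ j k, 0 ≤ R j k) ∧
    ∃ c : (n : ℕ) → Code n R, (∀ n, (c n).Admissible h P Pr) ∧
      Filter.Tendsto (fun n => (c n).errorProb h) Filter.atTop (nhds 0)}

/-- `C(x) = (1/2) log₂ (1 + x)`, in bits. -/
noncomputable def gaussianCap (x : ℝ) : ℝ := 1 / 2 * Real.logb 2 (1 + x)

end YChannel

/-! The bound is a genie-aided converse. From its own messages and output, user `j` decodes the
messages from `k` and `l`; if the message from `l` to `k` is also given, all messages of `l` are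
known, and the decoder of `l` then yields the message from `k` to `l`. So three messages are read
off from the outputs at `j` and `l`, a Gaussian channel with one input and two outputs, of total
gain `G = h_j² + h_l²`.

Mutual information is replaced by a change of measure. Let `g` be `h` with its `k`-th entry set to
zero, and let `Λ` be the log-likelihood ratio of the product law `N(0, I + Pr g gᵀ)^n` to the output
law given the messages and the relay noise. Since the relay input depends only on the past,
weighting by `exp Λ` gives the outputs that product law whatever the messages are
(`lintegral_causal`, `lintegral_noise_totalLogRatio`). Outputs independent of the messages allow
correct decoding of `N` triples with probability at most `1/N` (`card_decodesAt_mul_le`), so `E[exp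
Λ · (N 1_A + 1)] ≤ 2`, with `A` the event of correct decoding at `j` and `l`.

Convexity of `exp` turns this into `E Λ + P(A) log N ≤ log 2`, while the power constraint gives `E Λ
≥ -(n/2) log (1 + G Pr)` (`integral_totalLogRatio_ge`). The result, `log_numTriples_le`, is divided
by `n`, and `n → ∞`. -/

namespace YChannel

open MeasureTheory ProbabilityTheory
open scoped ENNReal

/-! ### Causal changes of variables on finite powers -/

section Causal

variable {E : Type*} [MeasurableSpace E]

/-- Splitting off the last coordinate of an integral over a finite power. -/
theorem lintegral_pi_snoc (μ : Measure E) [SigmaFinite μ] {n : ℕ} {f : (Fin (n + 1) → E) → ℝ≥0∞}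
    (hf : Measurable f) :
    ∫⁻ z, f z ∂(Measure.pi fun _ => μ) =
      ∫⁻ z, ∫⁻ w, f (Fin.snoc z w) ∂μ ∂(Measure.pi fun _ : Fin n => μ) := by
  have hmp := (measurePreserving_piFinSuccAbove (fun _ : Fin (n + 1) => μ) (Fin.last n)).symm
  rw [← hmp.lintegral_comp hf]
  refine (lintegral_prod_symm' _ (hf.comp (MeasurableEquiv.measurable _))).trans ?_
  simp [MeasurableEquiv.piFinSuccAbove, Fin.insertNthEquiv, Fin.insertNth_last']

/-- A causal change of variables: if a family of weighted maps `T a` carries `γ` to `κ`, then so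
does, for the finite powers, applying `T (X i z)` at each time `i`, when the parameter `X i z`
depends only on the coordinates of `z` before time `i`. -/
theorem lintegral_causal (γ κ : Measure E) [SigmaFinite γ] [SigmaFinite κ] [Nonempty E]
    {w : ℝ → E → ℝ≥0∞} {T : ℝ → E → E} (hw : Measurable (Function.uncurry w))
    (hT : Measurable (Function.uncurry T))
    (hwT : ∀ a (F : E → ℝ≥0∞), Measurable F → ∫⁻ z, w a z * F (T a z) ∂γ = ∫⁻ y, F y ∂κ)
    {n : ℕ} (X : Fin n → (Fin n → E) → ℝ) (hX : ∀ i, Measurable (X i))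
    (hX' : ∀ i z z', (∀ t < i, z t = z' t) → X i z = X i z')
    {F : (Fin n → E) → ℝ≥0∞} (hF : Measurable F) :
    ∫⁻ z, (∏ i, w (X i z) (z i)) * F (fun i => T (X i z) (z i)) ∂(Measure.pi fun _ => γ) =
      ∫⁻ y, F y ∂(Measure.pi fun _ => κ) := by
  induction n with
  | zero =>
    rw [Measure.pi_of_empty _ isEmptyElim, Measure.pi_of_empty _ isEmptyElim,
      lintegral_dirac' _ hF, lintegral_dirac' _ (by
        simp only [Finset.univ_eq_empty, Finset.prod_empty, one_mul]
        exact hF.fun_comp (measurable_pi_iff.2 isEmptyElim))]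
    simp only [Finset.univ_eq_empty, Finset.prod_empty, one_mul]
    congr 1
    exact Subsingleton.elim _ _
  | succ n ih =>
    obtain ⟨e⟩ := ‹Nonempty E›
    have hm : ∀ i : Fin (n + 1), Measurable fun z => T (X i z) (z i) := fun i =>
      hT.comp ((hX i).prodMk (measurable_pi_apply i))
    have hm' : ∀ i : Fin (n + 1), Measurable fun z => w (X i z) (z i) := fun i =>
      hw.comp ((hX i).prodMk (measurable_pi_apply i))
    have hsn : Measurable fun p : (Fin n → E) × E => (Fin.snoc p.1 p.2 : Fin (n + 1) → E) := by
      refine measurable_pi_iff.2 fun i => ?_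
      refine Fin.lastCases ?_ (fun i => ?_) i
      · simpa using measurable_snd
      · simpa [Function.comp_def] using (measurable_pi_apply (X := fun _ => E) i).comp measurable_fst
    have hsnoc : Measurable fun z : Fin n → E => (Fin.snoc z e : Fin (n + 1) → E) :=
      hsn.comp (measurable_id.prodMk measurable_const)
    -- The point `e` is a dummy last coordinate; by `key` its value is immaterial, even for the
    -- parameter at the last time.
    let X' : Fin n → (Fin n → E) → ℝ := fun i z => X i.castSucc (Fin.snoc z e)
    have key : ∀ i (z : Fin n → E) (u u' : E),
        X i (Fin.snoc z u : Fin (n + 1) → E) = X i (Fin.snoc z u' : Fin (n + 1) → E) := by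
      intro i z u u'
      refine hX' _ _ _ fun t ht => ?_
      obtain ⟨t, rfl⟩ := Fin.exists_castSucc_eq.2 (ne_of_lt (lt_of_lt_of_le ht (Fin.le_last i)))
      simp
    rw [lintegral_pi_snoc γ ((Finset.measurable_fun_prod _ fun i _ => hm' i).fun_mul
        (hF.fun_comp (measurable_pi_iff.2 hm))), lintegral_pi_snoc κ hF,
      -- The last coordinate is integrated first: with the past fixed its parameter is a constant,
      -- so `hwT` applies, and what remains is the shorter case for `F` averaged over its last
      -- argument.
      ← ih X' (fun i => (hX _).comp hsnoc) ?_
        (F := fun y => ∫⁻ u, F (Fin.snoc y u) ∂κ) (Measurable.lintegral_prod_right (hF.comp hsn))]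
    · refine lintegral_congr fun z => ?_
      have h1 : ∀ u : E, (fun i => T (X i (Fin.snoc z u : Fin (n + 1) → E))
            ((Fin.snoc z u : Fin (n + 1) → E) i)) =
          Fin.snoc (fun i => T (X' i z) (z i)) (T (X (Fin.last n) (Fin.snoc z e)) u) := by
        intro u
        ext i
        refine Fin.lastCases ?_ (fun i => ?_) i
        · simp [key _ z u e]
        · simp [key _ z u e, X']
      have hF1 : Measurable fun u => F (Fin.snoc (fun i => T (X' i z) (z i)) u) :=
        hF.fun_comp (hsn.fun_comp (measurable_const.prodMk measurable_id))
      rw [← hwT (X (Fin.last n) (Fin.snoc z e)) _ hF1, ← lintegral_const_mul]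
      · refine lintegral_congr fun u => ?_
        rw [h1, Fin.prod_univ_castSucc]
        simp [key _ z u e, X', mul_assoc]
      · exact (hw.comp (measurable_const.prodMk measurable_id)).mul
          (hF1.comp (hT.comp (measurable_const.prodMk measurable_id)))
    · intro i z z' h
      refine hX' _ _ _ fun t ht => ?_
      obtain ⟨t, rfl⟩ := Fin.exists_castSucc_eq.2 (ne_of_lt (lt_of_lt_of_le ht (Fin.le_last _)))
      simpa using h t (by simpa using ht)

end Causal

/-! ### Gaussian translations and quadratic tilts -/

/-- The Cameron–Martin formula on the line. -/
theorem lintegral_gaussianReal_translate (a : ℝ) {F : ℝ → ℝ≥0∞} (hF : Measurable F) :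
    ∫⁻ z, ENNReal.ofReal (Real.exp (-(a * z) - a ^ 2 / 2)) * F (z + a) ∂(gaussianReal 0 1) =
      ∫⁻ y, F y ∂(gaussianReal 0 1) := by
  rw [gaussianReal_of_var_ne_zero _ one_ne_zero,
    lintegral_withDensity_eq_lintegral_mul _ (measurable_gaussianPDF 0 1) (by fun_prop),
    lintegral_withDensity_eq_lintegral_mul _ (measurable_gaussianPDF 0 1) hF]
  refine Eq.trans ?_ (lintegral_add_right_eq_self _ a)
  refine lintegral_congr fun z => ?_
  simp only [Pi.mul_apply, gaussianPDF, gaussianPDFReal, ← mul_assoc]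
  rw [← ENNReal.ofReal_mul (by positivity), mul_assoc, ← Real.exp_add]
  congr 4
  simp
  ring

/-- The law of a vector of independent standard Gaussian variables. -/
noncomputable abbrev gaussianVec : Measure (Fin 3 → ℝ) :=
  Measure.pi fun _ => gaussianReal 0 1

/-- The Cameron–Martin formula in three dimensions, along the direction `g`. -/
theorem lintegral_gaussianVec_translate (g : Fin 3 → ℝ) (a : ℝ) {F : (Fin 3 → ℝ) → ℝ≥0∞}
    (hF : Measurable F) :
    ∫⁻ z, ENNReal.ofReal (Real.exp (-(a * ∑ u, g u * z u) - a ^ 2 * (∑ u, g u ^ 2) / 2)) *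
        F (fun u => z u + a * g u) ∂gaussianVec = ∫⁻ y, F y ∂gaussianVec := by
  -- The three coordinates play the role of times, with constant shifts `a * g u`.
  rw [← lintegral_causal (gaussianReal 0 1) (gaussianReal 0 1)
    (w := fun a z => ENNReal.ofReal (Real.exp (-(a * z) - a ^ 2 / 2))) (T := fun a z => z + a)
    (by unfold Function.uncurry; fun_prop) (by unfold Function.uncurry; fun_prop)
    (fun a F hF => lintegral_gaussianReal_translate a hF)
    (fun u _ => a * g u) (fun _ => measurable_const) (fun _ _ _ _ => rfl) hF]
  refine lintegral_congr fun z => ?_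
  rw [← ENNReal.ofReal_prod_of_nonneg (fun _ _ => by positivity), ← Real.exp_sum]
  congr 3
  simp only [Fin.sum_univ_three]
  ring

theorem memLp_dot_gaussianVec (g : Fin 3 → ℝ) :
    MemLp (fun z => ∑ u, g u * z u) 2 gaussianVec := by
  refine memLp_finsetSum _ fun u _ => MemLp.const_mul ?_ _
  exact (memLp_id_gaussianReal' 2 (by simp)).comp_measurePreserving
    (measurePreserving_eval (fun _ : Fin 3 => gaussianReal 0 1) u)

/-- A linear form of a standard Gaussian vector is Gaussian. -/
theorem map_dot_gaussianVec (g : Fin 3 → ℝ) :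
    gaussianVec.map (fun z => ∑ u, g u * z u) =
      gaussianReal 0 (Real.toNNReal (∑ u, g u ^ 2)) := by
  have hmp : ∀ u : Fin 3, MeasurePreserving (fun z : Fin 3 → ℝ => z u) gaussianVec
      (gaussianReal 0 1) := fun u => measurePreserving_eval (fun _ : Fin 3 => gaussianReal 0 1) u
  have hlaw : ∀ u : Fin 3, HasGaussianLaw (fun z : Fin 3 → ℝ => g u * z u) gaussianVec := by
    intro u
    refine ⟨?_⟩
    have h1 : (fun z : Fin 3 → ℝ => g u * z u) = (fun x => g u * x) ∘ fun z => z u := rfl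
    rw [h1, ← Measure.map_map (by fun_prop) (by fun_prop), (hmp u).map_eq,
      gaussianReal_map_const_mul]
    infer_instance
  have hind : iIndepFun (fun (u : Fin 3) (z : Fin 3 → ℝ) => g u * z u) gaussianVec :=
    iIndepFun_pi (X := fun u x => g u * x) (fun u => by fun_prop)
  have hsum := (iIndepFun.hasGaussianLaw_fun_sum hlaw hind).map_eq_gaussianReal
  rw [hsum]
  have hint : ∀ u : Fin 3, Integrable (fun z : Fin 3 → ℝ => g u * z u) gaussianVec := fun u =>
    (((memLp_id_gaussianReal' 1 (by simp)).comp_measurePreserving (hmp u)).integrable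
      le_rfl).const_mul _
  have hmean : ∫ z, ∑ u, g u * z u ∂gaussianVec = 0 := by
    rw [integral_finsetSum _ fun u _ => hint u]
    refine Finset.sum_eq_zero fun u _ => ?_
    have h0 := integral_map (hmp u).measurable.aemeasurable (μ := gaussianVec) (f := fun x => x)
      (by fun_prop)
    rw [(hmp u).map_eq, integral_id_gaussianReal] at h0
    rw [integral_const_mul, ← h0, mul_zero]
  have hvar : Var[fun z => ∑ u, g u * z u; gaussianVec] = ∑ u, g u ^ 2 := by
    have h1 : (fun z : Fin 3 → ℝ => ∑ u, g u * z u) =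
        ∑ u, fun z : Fin 3 → ℝ => (fun x => g u * x) (z u) := by ext; simp
    rw [h1, variance_sum_pi (X := fun u x => g u * x)
      fun u => (memLp_id_gaussianReal' 2 (by simp)).const_mul _]
    refine Finset.sum_congr rfl fun u _ => ?_
    rw [variance_const_mul, variance_fun_id_gaussianReal]
    simp
  rw [hmean, hvar]

theorem integral_dot_sq_gaussianVec (g : Fin 3 → ℝ) :
    ∫ z, (∑ u, g u * z u) ^ 2 ∂gaussianVec = ∑ u, g u ^ 2 := by
  have hm : Measurable fun z : Fin 3 → ℝ => ∑ u, g u * z u := by fun_prop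
  have h := integral_map (μ := gaussianVec) (φ := fun z => ∑ u, g u * z u)
    (f := fun x => x ^ 2) hm.aemeasurable (by fun_prop)
  have hv := variance_fun_id_gaussianReal (μ := 0) (v := Real.toNNReal (∑ u, g u ^ 2))
  rw [variance_of_integral_eq_zero (by fun_prop) integral_id_gaussianReal,
    ← map_dot_gaussianVec, h, Real.coe_toNNReal _ (by positivity)] at hv
  exact hv

/-- The exponential tilt `exp (c x² / 2)` of a centred Gaussian law, normalised. -/
theorem lintegral_exp_sq_gaussianReal (v : NNReal) {p : ℝ} (hp : 0 ≤ p) :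
    ∫⁻ x, ENNReal.ofReal (Real.exp (p / (1 + v * p) * x ^ 2 / 2 - Real.log (1 + v * p) / 2))
      ∂(gaussianReal 0 v) = 1 := by
  rcases eq_or_ne v 0 with rfl | hv
  · rw [gaussianReal_zero_var, lintegral_dirac]
    simp
  have hv' : (0 : ℝ) < v := by positivity
  have hs : (0 : ℝ) < 1 + v * p := by positivity
  -- The tilted law is centred Gaussian of variance `w = v (1 + v p)`, because `1/v - 1/w = p / (1 +
  -- v p)`; its total mass is one.
  set w : NNReal := v * ⟨1 + v * p, hs.le⟩ with hwdef
  have hw : (w : ℝ) = v * (1 + v * p) := rfl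
  have hw0 : w ≠ 0 := by
    rw [← NNReal.coe_ne_zero, hw]; positivity
  rw [gaussianReal_of_var_ne_zero _ hv,
    lintegral_withDensity_eq_lintegral_mul _ (measurable_gaussianPDF 0 v) (by fun_prop),
    ← lintegral_gaussianPDF_eq_one 0 hw0]
  refine lintegral_congr fun x => ?_
  simp only [Pi.mul_apply, gaussianPDF, gaussianPDFReal]
  rw [← ENNReal.ofReal_mul (by positivity), hw]
  congr 1
  have hsq : Real.exp (-(Real.log (1 + v * p) / 2)) = (√(1 + v * p))⁻¹ := by
    rw [Real.exp_neg, ← Real.log_sqrt hs.le, Real.exp_log (Real.sqrt_pos.2 hs)]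
  have hexp : -(x - 0) ^ 2 / (2 * ↑v) + p / (1 + v * p) * x ^ 2 / 2 =
      -(x - 0) ^ 2 / (2 * (v * (1 + v * p))) := by
    field_simp
    ring
  rw [sub_eq_add_neg (p / (1 + v * p) * x ^ 2 / 2), mul_assoc, ← Real.exp_add, ← add_assoc, hexp,
    Real.exp_add, hsq, ← mul_assoc (2 * Real.pi), Real.sqrt_mul (x := 2 * Real.pi * v) (by positivity), mul_inv]
  ac_rfl

/-- The density of a centred Gaussian law with covariance `I + p g gᵀ` with respect to the
standard one has total mass one. -/
theorem lintegral_exp_sq_gaussianVec (g : Fin 3 → ℝ) {p : ℝ} (hp : 0 ≤ p) :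
    ∫⁻ z, ENNReal.ofReal (Real.exp (p / (1 + (∑ u, g u ^ 2) * p) * (∑ u, g u * z u) ^ 2 / 2 -
      Real.log (1 + (∑ u, g u ^ 2) * p) / 2)) ∂gaussianVec = 1 := by
  have h := lintegral_exp_sq_gaussianReal (Real.toNNReal (∑ u, g u ^ 2)) hp
  rw [← map_dot_gaussianVec, lintegral_map (by fun_prop) (by fun_prop),
    Real.coe_toNNReal _ (by positivity)] at h
  exact h

/-- The law of the matrix of independent standard Gaussian variables does not depend on the order
of the two indices. -/
theorem measurePreserving_swap_pi {ι κ : Type*} [Fintype ι] [Fintype κ] {E : Type*}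
    [MeasurableSpace E] (μ : Measure E) [IsProbabilityMeasure μ] :
    MeasurePreserving (Function.swap : (ι → κ → E) → κ → ι → E)
      (Measure.pi fun _ => Measure.pi fun _ => μ) (Measure.pi fun _ => Measure.pi fun _ => μ) := by
  have h : (Function.swap : (ι → κ → E) → κ → ι → E) =
      MeasurableEquiv.curry κ ι E ∘
        MeasurableEquiv.piCongrLeft (fun _ => E) (Equiv.prodComm ι κ) ∘
          (MeasurableEquiv.curry ι κ E).symm := by
    ext f k i
    rfl
  refine ⟨by rw [h]; fun_prop, ?_⟩
  simp_rw [← Measure.infinitePi_eq_pi]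
  rw [h, ← Measure.map_map (by fun_prop) (by fun_prop),
    ← Measure.map_map (by fun_prop) (by fun_prop),
    Measure.infinitePi_map_curry_symm (fun _ _ => μ),
    Measure.infinitePi_map_piCongrLeft (X := fun _ => E) (fun _ => μ) (Equiv.prodComm ι κ),
    Measure.infinitePi_map_curry (fun _ _ => μ)]

/-! ### Measurability and causality of the channel -/

variable {n : ℕ} {R : Rates}

theorem measurable_received (h : Fin 3 → ℝ) (c : Code n R) (i : Fin n) :
    Measurable fun ω => received h c ω i := by
  induction i using WellFoundedLT.induction with
  | ind i ih =>
    have ih' : ∀ t : Fin i, Measurable fun ω => received h c ω ⟨t, t.2.trans i.2⟩ :=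
      fun t => ih _ (Fin.mk_lt_of_lt_val t.2)
    have hrel : Measurable fun ω : Sample n R =>
        c.relayEnc i fun t => (received h c ω ⟨t, t.2.trans i.2⟩).2 :=
      (c.measurable_relayEnc i).comp (measurable_pi_iff.2 fun t => (ih' t).snd)
    have henc : ∀ j, Measurable fun ω : Sample n R =>
        c.enc j i (ω.1 j, fun t => (received h c ω ⟨t, t.2.trans i.2⟩).1 j) := fun j =>
      (c.measurable_enc j i).comp (((measurable_pi_apply j).comp measurable_fst).prodMk
        (measurable_pi_iff.2 fun t => (measurable_pi_apply j).comp (ih' t).fst))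
    have heq : (fun ω => received h c ω i) = fun ω : Sample n R =>
        (fun j => h j * c.relayEnc i (fun t => (received h c ω ⟨t, t.2.trans i.2⟩).2) + ω.2.1 j i,
        ∑ j, h j * c.enc j i (ω.1 j, fun t => (received h c ω ⟨t, t.2.trans i.2⟩).1 j) +
          ω.2.2 i) := by
      ext1 ω
      rw [received]
    rw [heq]
    refine Measurable.prodMk (measurable_pi_iff.2 fun j => (hrel.const_mul _).add (by fun_prop))
      (Measurable.add (Finset.measurable_fun_sum _ fun j _ => (henc j).const_mul _) (by fun_prop))

theorem measurable_relayInput (h : Fin 3 → ℝ) (c : Code n R) (i : Fin n) :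
    Measurable (relayInput h c i) :=
  (c.measurable_relayEnc i).comp (measurable_pi_iff.2 fun _ => (measurable_received h c _).snd)

theorem received_congr (h : Fin 3 → ℝ) (c : Code n R) (m : Messages n R)
    {z z' : Fin 3 → Fin n → ℝ} (zr : Fin n → ℝ) (i : Fin n)
    (hz : ∀ t ≤ i, ∀ j, z j t = z' j t) :
    received h c (m, z, zr) i = received h c (m, z', zr) i := by
  induction i using WellFoundedLT.induction with
  | ind i ih =>
    have ih' : ∀ t : Fin i, received h c (m, z, zr) ⟨t, t.2.trans i.2⟩ =
        received h c (m, z', zr) ⟨t, t.2.trans i.2⟩ :=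
      fun t => ih _ (Fin.mk_lt_of_lt_val t.2) fun t' ht' =>
        hz t' (ht'.trans (Fin.mk_lt_of_lt_val t.2).le)
    rw [received, received]
    simp only [ih', hz i le_rfl]

/-- The relay input does not depend on present and future noise at the users. -/
theorem relayInput_congr (h : Fin 3 → ℝ) (c : Code n R) (m : Messages n R)
    {z z' : Fin 3 → Fin n → ℝ} (zr : Fin n → ℝ) (i : Fin n)
    (hz : ∀ t < i, ∀ j, z j t = z' j t) :
    relayInput h c i (m, z, zr) = relayInput h c i (m, z', zr) := by
  unfold relayInput relayOutput
  congr 1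
  ext t
  rw [received_congr h c m zr _ fun t' ht' =>
    hz t' (lt_of_le_of_lt ht' (Fin.mk_lt_of_lt_val t.2))]

/-! ### Counting the messages compatible with given outputs -/

theorem univ_subtype_ne {a b d : Fin 3} (hb : b ≠ a) (hd : d ≠ a) (hbd : b ≠ d) :
    (Finset.univ : Finset {x : Fin 3 // x ≠ a}) = {⟨b, hb⟩, ⟨d, hd⟩} := by
  ext ⟨x, hx⟩
  simp only [Finset.mem_univ, Finset.mem_insert, Finset.mem_singleton, Subtype.mk.injEq, true_iff]
  omega

theorem prod_subtype_ne {a b d : Fin 3} (hb : b ≠ a) (hd : d ≠ a) (hbd : b ≠ d)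
    (f : {x : Fin 3 // x ≠ a} → ℕ) : ∏ x, f x = f ⟨b, hb⟩ * f ⟨d, hd⟩ := by
  rw [univ_subtype_ne hb hd hbd, Finset.prod_pair (by simpa using hbd)]

theorem prod_fin_three {j k l : Fin 3} (hjk : j ≠ k) (hjl : j ≠ l) (hlk : l ≠ k) (f : Fin 3 → ℕ) :
    ∏ x, f x = f j * f k * f l := by
  have : (Finset.univ : Finset (Fin 3)) = {j, k, l} := by
    ext x
    simp only [Finset.mem_univ, Finset.mem_insert, Finset.mem_singleton, true_iff]
    omega
  rw [this, Finset.prod_insert (by simp [hjk, hjl]), Finset.prod_pair hlk.symm, mul_assoc]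

/-- Users `j` and `l` decode correctly when the symbols received at time `i` are `v i`. -/
def DecodesAt (c : Code n R) (j l : Fin 3) (m : Messages n R) (v : Fin n → Fin 3 → ℝ) : Prop :=
  c.dec j (fun i => v i j, m j) = wanted m j ∧ c.dec l (fun i => v i l, m l) = wanted m l

/-- With the outputs fixed, a correctly decoded tuple is determined by both messages of `j` and the
one from `l` to `k`: decoder `j` supplies the messages to `j`, which completes those of `l`, and
decoder `l` then supplies the message from `k` to `l`. The other three messages contribute the
factor on the left. -/
theorem card_decodesAt_mul_le (c : Code n R) {j k l : Fin 3} (hjk : j ≠ k) (hjl : j ≠ l)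
    (hlk : l ≠ k) (v : Fin n → Fin 3 → ℝ) :
    Nat.card {m : Messages n R // DecodesAt c j l m v} *
      (⌊(2 : ℝ) ^ ((n : ℝ) * R k ⟨j, hjk⟩)⌋₊ * ⌊(2 : ℝ) ^ ((n : ℝ) * R l ⟨j, hjl⟩)⌋₊ *
        ⌊(2 : ℝ) ^ ((n : ℝ) * R k ⟨l, hlk⟩)⌋₊) ≤ Fintype.card (Messages n R) := by
  have hinj : Function.Injective fun m : {m : Messages n R // DecodesAt c j l m v} =>
      (m.1 j, m.1 l ⟨k, hlk.symm⟩) := by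
    rintro ⟨m, hm, hm'⟩ ⟨m₂, hm₂, hm₂'⟩ heq
    simp only [Prod.mk.injEq] at heq
    obtain ⟨hj, hlk'⟩ := heq
    have hw : wanted m j = wanted m₂ j := by rw [← hm, ← hm₂, hj]
    have hkj : m k ⟨j, hjk⟩ = m₂ k ⟨j, hjk⟩ := congrFun hw ⟨k, hjk.symm⟩
    have hlj : m l ⟨j, hjl⟩ = m₂ l ⟨j, hjl⟩ := congrFun hw ⟨l, hjl.symm⟩
    have hl : m l = m₂ l := by
      ext1 x
      have hx : x ∈ (Finset.univ : Finset {x : Fin 3 // x ≠ l}) := Finset.mem_univ x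
      rw [univ_subtype_ne hjl hlk.symm hjk, Finset.mem_insert, Finset.mem_singleton] at hx
      rcases hx with rfl | rfl
      exacts [hlj, hlk']
    have hw' : wanted m l = wanted m₂ l := by rw [← hm', ← hm₂', hl]
    have hkl : m k ⟨l, hlk⟩ = m₂ k ⟨l, hlk⟩ := congrFun hw' ⟨k, hlk.symm⟩
    have hk : m k = m₂ k := by
      ext1 x
      have hx : x ∈ (Finset.univ : Finset {x : Fin 3 // x ≠ k}) := Finset.mem_univ x
      rw [univ_subtype_ne hjk hlk hjl, Finset.mem_insert, Finset.mem_singleton] at hx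
      rcases hx with rfl | rfl
      exacts [hkj, hkl]
    refine Subtype.ext (funext fun x => ?_)
    have hx : x = j ∨ x = k ∨ x = l := by omega
    rcases hx with rfl | rfl | rfl
    exacts [hj, hk, hl]
  have hcard := Nat.card_le_card_of_injective _ hinj
  simp only [Nat.card_eq_fintype_card, Fintype.card_prod, Fintype.card_pi, Fintype.card_fin]
    at hcard ⊢
  rw [prod_subtype_ne hjk.symm hjl.symm hlk.symm] at hcard
  rw [prod_fin_three hjk hjl hlk, prod_subtype_ne hjk.symm hjl.symm hlk.symm,
    prod_subtype_ne hjk hlk hjl, prod_subtype_ne hjl hlk.symm hjk]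
  calc _ ≤ _ := Nat.mul_le_mul_right _ hcard
    _ = _ := by ring

/-! ### The likelihood ratio against the Gaussian output law -/

/-- The logarithm of the density of the output law when the input is `N(0, p)`, relative to the
output law when the input is `a`, as a function of the noise component `x` along `g`; here
`G` is the squared norm of `g`. -/
noncomputable def logRatio (G p a x : ℝ) : ℝ :=
  p / (1 + G * p) * (G * a + x) ^ 2 / 2 - Real.log (1 + G * p) / 2 - a * x - a ^ 2 * G / 2

/-- The density of `N(0, I + p g gᵀ)` relative to `N(0, I)`. -/
noncomputable def mixDensity (g : Fin 3 → ℝ) (p : ℝ) (z : Fin 3 → ℝ) : ℝ≥0∞ :=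
  ENNReal.ofReal (Real.exp (p / (1 + (∑ u, g u ^ 2) * p) * (∑ u, g u * z u) ^ 2 / 2 -
      Real.log (1 + (∑ u, g u ^ 2) * p) / 2))

theorem measurable_mixDensity (g : Fin 3 → ℝ) (p : ℝ) : Measurable (mixDensity g p) := by
  unfold mixDensity; fun_prop

/-- The law `N(0, I + p g gᵀ)`. -/
noncomputable def mixLaw (g : Fin 3 → ℝ) (p : ℝ) : Measure (Fin 3 → ℝ) :=
  gaussianVec.withDensity (mixDensity g p)

theorem isProbabilityMeasure_mixLaw (g : Fin 3 → ℝ) {p : ℝ} (hp : 0 ≤ p) :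
    IsProbabilityMeasure (mixLaw g p) := by
  refine ⟨?_⟩
  rw [mixLaw, withDensity_apply _ MeasurableSet.univ, setLIntegral_univ]
  exact lintegral_exp_sq_gaussianVec g hp

/-- One channel use: Cameron–Martin applied to `mixDensity * F`, whose two exponents add up to
`logRatio`. -/
theorem lintegral_logRatio (g : Fin 3 → ℝ) (p a : ℝ) {F : (Fin 3 → ℝ) → ℝ≥0∞} (hF : Measurable F) :
    ∫⁻ z, ENNReal.ofReal (Real.exp (logRatio (∑ u, g u ^ 2) p a (∑ u, g u * z u))) *
      F (fun u => z u + a * g u) ∂gaussianVec = ∫⁻ y, F y ∂(mixLaw g p) := by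
  rw [mixLaw, lintegral_withDensity_eq_lintegral_mul _ (measurable_mixDensity g p) hF,
    ← lintegral_gaussianVec_translate g a ((measurable_mixDensity g p).mul hF)]
  refine lintegral_congr fun z => ?_
  rw [Pi.mul_apply, ← mul_assoc]
  congr 1
  rw [mixDensity, ← ENNReal.ofReal_mul (by positivity), ← Real.exp_add]
  congr 2
  have : ∑ u, g u * (z u + a * g u) = (∑ u, g u ^ 2) * a + ∑ u, g u * z u := by
    simp only [Fin.sum_univ_three]; ring
  rw [this, logRatio]
  ring

theorem measurable_mul_gaussian (g : Fin 3 → ℝ) :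
    Measurable fun z : Fin 3 → ℝ => ∑ u, g u * z u := by fun_prop

/-- The component along `g` of the users' noise at time `i`. -/
noncomputable def noiseAlong (g : Fin 3 → ℝ) (i : Fin n) (ω : Sample n R) : ℝ :=
  ∑ u, g u * ω.2.1 u i

/-- The channel outputs at the users for the coefficient vector `g`. -/
noncomputable def outputAlong (h : Fin 3 → ℝ) (c : Code n R) (g : Fin 3 → ℝ) (ω : Sample n R) :
    Fin n → Fin 3 → ℝ :=
  fun i u => ω.2.1 u i + relayInput h c i ω * g u

theorem measurable_noiseAlong (g : Fin 3 → ℝ) (i : Fin n) :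
    Measurable (noiseAlong (R := R) g i) := by
  unfold noiseAlong; fun_prop

theorem measurable_outputAlong (h : Fin 3 → ℝ) (c : Code n R) (g : Fin 3 → ℝ) :
    Measurable (outputAlong h c g) :=
  measurable_pi_iff.2 fun i => measurable_pi_iff.2 fun u =>
    Measurable.add (by fun_prop) ((measurable_relayInput h c i).mul_const _)

/-- The total log-likelihood ratio. -/
noncomputable def totalLogRatio (h : Fin 3 → ℝ) (c : Code n R) (g : Fin 3 → ℝ) (p : ℝ)
    (ω : Sample n R) : ℝ :=
  ∑ i, logRatio (∑ u, g u ^ 2) p (relayInput h c i ω) (noiseAlong g i ω)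

theorem measurable_logRatio (G p : ℝ) : Measurable (Function.uncurry (logRatio G p)) := by
  unfold Function.uncurry logRatio; fun_prop

theorem measurable_totalLogRatio (h : Fin 3 → ℝ) (c : Code n R) (g : Fin 3 → ℝ) (p : ℝ) :
    Measurable (totalLogRatio h c g p) := by
  have hterm : ∀ i, Measurable fun ω : Sample n R =>
      logRatio (∑ u, g u ^ 2) p (relayInput h c i ω) (noiseAlong g i ω) := by
    intro i
    have hX := measurable_relayInput h c i
    have hN := measurable_noiseAlong (R := R) g i
    unfold logRatio
    fun_prop
  unfold totalLogRatio
  exact Finset.measurable_fun_sum Finset.univ fun i _ => hterm i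

theorem nonempty_messages (hR : ∀ j k, 0 ≤ R j k) : Nonempty (Messages n R) := by
  refine ⟨fun j k => ⟨0, ?_⟩⟩
  refine Nat.floor_pos.2 (Real.one_le_rpow one_le_two ?_)
  have := hR j k
  positivity

theorem isProbabilityMeasure_law (hR : ∀ j k, 0 ≤ R j k) : IsProbabilityMeasure (law n R) := by
  have := nonempty_messages (n := n) hR
  have : IsProbabilityMeasure (uniformOn (Set.univ : Set (Messages n R))) :=
    isProbabilityMeasure_uniformOn Set.finite_univ Set.univ_nonempty
  unfold law
  infer_instance

/-- For given messages and relay noise, the likelihood ratio makes the outputs independent with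
law `mixLaw`, whatever the code. -/
theorem lintegral_noise_totalLogRatio (h : Fin 3 → ℝ) (c : Code n R) (g : Fin 3 → ℝ) {p : ℝ}
    (hp : 0 ≤ p) (m : Messages n R) (zr : Fin n → ℝ) {F : (Fin n → Fin 3 → ℝ) → ℝ≥0∞}
    (hF : Measurable F) :
    ∫⁻ z, ENNReal.ofReal (Real.exp (totalLogRatio h c g p (m, z, zr))) *
        F (outputAlong h c g (m, z, zr))
        ∂(Measure.pi fun _ : Fin 3 => Measure.pi fun _ : Fin n => gaussianReal 0 1) =
      ∫⁻ y, F y ∂(Measure.pi fun _ : Fin n => mixLaw g p) := by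
  have := isProbabilityMeasure_mixLaw g hp
  have hs : Measurable (Function.swap : (Fin n → Fin 3 → ℝ) → Fin 3 → Fin n → ℝ) :=
    (measurePreserving_swap_pi (ι := Fin n) (κ := Fin 3) (gaussianReal 0 1)).measurable
  have hmk : Measurable fun z : Fin 3 → Fin n → ℝ => ((m, z, zr) : Sample n R) :=
    measurable_const.prodMk (measurable_id.prodMk measurable_const)
  have hw := measurable_logRatio (∑ u, g u ^ 2) p
  -- The noise is regrouped by time, so that each time step carries one vector in `ℝ³` and causality
  -- can be used.
  rw [← (measurePreserving_swap_pi (ι := Fin n) (κ := Fin 3) (gaussianReal 0 1)).lintegral_comp,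
    ← lintegral_causal gaussianVec (mixLaw g p)
      (w := fun a z => ENNReal.ofReal (Real.exp (logRatio (∑ u, g u ^ 2) p a (∑ u, g u * z u))))
      (T := fun a z u => z u + a * g u)
      (X := fun i z => relayInput h c i (m, Function.swap z, zr)) _ _
      (fun a F hF => lintegral_logRatio g p a hF) _ _ hF]
  · refine lintegral_congr fun z => ?_
    rw [← ENNReal.ofReal_prod_of_nonneg (fun _ _ => by positivity), ← Real.exp_sum]
    rfl
  · refine (Real.measurable_exp.comp (hw.comp (measurable_fst.prodMk ?_))).ennreal_ofReal
    exact (measurable_mul_gaussian g).comp measurable_snd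
  · unfold Function.uncurry; fun_prop
  · exact fun i => (measurable_relayInput h c i).comp (hmk.comp hs)
  · exact fun i z z' hz => relayInput_congr h c m zr i fun t ht j => by
      simp [Function.swap, hz t ht]
  · exact ((Real.measurable_exp.comp
      ((measurable_totalLogRatio h c g p).comp hmk)).ennreal_ofReal).mul
      (hF.comp ((measurable_outputAlong h c g).comp hmk))

/-! ### Correct decoding under the changed measure -/

theorem measurable_wanted (j : Fin 3) : Measurable fun m : Messages n R => wanted m j :=
  measurable_of_countable _

theorem measurableSet_decodesAt (c : Code n R) (j l : Fin 3) :
    MeasurableSet {q : Messages n R × (Fin n → Fin 3 → ℝ) | DecodesAt c j l q.1 q.2} := by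
  have hdec : ∀ u, Measurable fun q : Messages n R × (Fin n → Fin 3 → ℝ) =>
      c.dec u (fun i => q.2 i u, q.1 u) := fun u =>
    (c.measurable_dec u).comp (Measurable.prodMk (by fun_prop) (by fun_prop))
  have hw : ∀ u, Measurable fun q : Messages n R × (Fin n → Fin 3 → ℝ) => wanted q.1 u :=
    fun u => (measurable_wanted u).comp measurable_fst
  exact (measurableSet_eq_fun (hdec j) (hw j)).inter (measurableSet_eq_fun (hdec l) (hw l))

/-- The number of values of the three messages that users `j` and `l` can recover together. -/
noncomputable def numTriples (n : ℕ) (R : Rates) {j k l : Fin 3} (hjk : j ≠ k) (hjl : j ≠ l)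
    (hlk : l ≠ k) : ℕ :=
  ⌊(2 : ℝ) ^ ((n : ℝ) * R k ⟨j, hjk⟩)⌋₊ * ⌊(2 : ℝ) ^ ((n : ℝ) * R l ⟨j, hjl⟩)⌋₊ *
    ⌊(2 : ℝ) ^ ((n : ℝ) * R k ⟨l, hlk⟩)⌋₊

/-- The number of triples on the event of correct decoding, and one elsewhere. -/
noncomputable def decodeWeight (c : Code n R) {j k l : Fin 3} (hjk : j ≠ k) (hjl : j ≠ l)
    (hlk : l ≠ k) (q : Messages n R × (Fin n → Fin 3 → ℝ)) : ℝ :=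
  {q : Messages n R × (Fin n → Fin 3 → ℝ) | DecodesAt c j l q.1 q.2}.indicator
    (fun _ => (numTriples n R hjk hjl hlk : ℝ)) q + 1

/-- For fixed outputs, counting bounds the probability of correct decoding over uniform messages by
`1 / numTriples`; the indicator part thus contributes at most one, and the constant part exactly
one. -/
theorem lintegral_decodeWeight_le (hR : ∀ j k, 0 ≤ R j k) (c : Code n R) {j k l : Fin 3}
    (hjk : j ≠ k) (hjl : j ≠ l) (hlk : l ≠ k) (v : Fin n → Fin 3 → ℝ) :
    ∫⁻ m, ENNReal.ofReal (decodeWeight c hjk hjl hlk (m, v))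
      ∂(uniformOn (Set.univ : Set (Messages n R))) ≤ 2 := by
  have := nonempty_messages (n := n) hR
  have : IsProbabilityMeasure (uniformOn (Set.univ : Set (Messages n R))) :=
    isProbabilityMeasure_uniformOn Set.finite_univ Set.univ_nonempty
  have h1 : ∀ m : Messages n R, ENNReal.ofReal (decodeWeight c hjk hjl hlk (m, v)) =
      {m | DecodesAt c j l m v}.indicator
        (fun _ => (numTriples n R hjk hjl hlk : ℝ≥0∞)) m + 1 := by
    intro m
    by_cases hm : DecodesAt c j l m v
    · simp [decodeWeight, hm, ENNReal.ofReal_add]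
    · simp [decodeWeight, hm]
  have hms : MeasurableSet {m : Messages n R | DecodesAt c j l m v} := Set.to_countable _ |>.measurableSet
  simp_rw [h1]
  rw [lintegral_add_right _ measurable_const, lintegral_indicator_const hms, lintegral_const,
    measure_univ, mul_one]
  refine (add_le_add ?_ le_rfl).trans_eq one_add_one_eq_two
  rw [uniformOn_univ, Measure.count_apply hms, ← mul_div_assoc]
  refine ENNReal.div_le_of_le_mul ?_
  rw [one_mul, ← (Set.toFinite _).cast_ncard_eq, ← Nat.card_coe_set_eq, mul_comm]
  exact_mod_cast card_decodesAt_mul_le c hjk hjl hlk v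

/-- The likelihood ratio, weighted by the number of triples on correct decoding, has expectation
at most two. -/
theorem lintegral_totalLogRatio_decodeWeight_le (hR : ∀ j k, 0 ≤ R j k) (h : Fin 3 → ℝ)
    (c : Code n R) (g : Fin 3 → ℝ) {p : ℝ} (hp : 0 ≤ p) {j k l : Fin 3}
    (hjk : j ≠ k) (hjl : j ≠ l) (hlk : l ≠ k) :
    ∫⁻ ω, ENNReal.ofReal (Real.exp (totalLogRatio h c g p ω)) *
      ENNReal.ofReal (decodeWeight c hjk hjl hlk (ω.1, outputAlong h c g ω)) ∂(law n R) ≤ 2 := by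
  have := nonempty_messages (n := n) hR
  have : IsProbabilityMeasure (uniformOn (Set.univ : Set (Messages n R))) :=
    isProbabilityMeasure_uniformOn Set.finite_univ Set.univ_nonempty
  have := isProbabilityMeasure_mixLaw g hp
  have hW : Measurable (decodeWeight c hjk hjl hlk) :=
    (measurable_const.indicator (measurableSet_decodesAt c j l)).add measurable_const
  have hmeas : Measurable fun ω : Sample n R =>
      ENNReal.ofReal (Real.exp (totalLogRatio h c g p ω)) *
        ENNReal.ofReal (decodeWeight c hjk hjl hlk (ω.1, outputAlong h c g ω)) :=
    (Real.measurable_exp.comp (measurable_totalLogRatio h c g p)).ennreal_ofReal.mul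
      (hW.comp (measurable_fst.prodMk (measurable_outputAlong h c g))).ennreal_ofReal
  rw [law, lintegral_prod _ hmeas.aemeasurable]
  have h1 : ∀ m : Messages n R, ∫⁻ y : (Fin 3 → Fin n → ℝ) × (Fin n → ℝ),
      ENNReal.ofReal (Real.exp (totalLogRatio h c g p (m, y))) *
        ENNReal.ofReal (decodeWeight c hjk hjl hlk (m, outputAlong h c g (m, y)))
      ∂((Measure.pi fun _ : Fin 3 => Measure.pi fun _ : Fin n =>
        gaussianReal 0 1).prod (Measure.pi fun _ : Fin n => gaussianReal 0 1)) =
      ∫⁻ v, ENNReal.ofReal (decodeWeight c hjk hjl hlk (m, v))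
        ∂(Measure.pi fun _ : Fin n => mixLaw g p) := by
    intro m
    have hmk : Measurable fun y : (Fin 3 → Fin n → ℝ) × (Fin n → ℝ) => ((m, y) : Sample n R) :=
      measurable_const.prodMk measurable_id
    rw [lintegral_prod_symm' _ (hmeas.fun_comp hmk)]
    simp_rw [lintegral_noise_totalLogRatio h c g hp m _
      (F := fun v => ENNReal.ofReal (decodeWeight c hjk hjl hlk (m, v)))
      (hW.fun_comp (measurable_const.prodMk measurable_id)).ennreal_ofReal]
    simp
  simp_rw [h1]
  -- The output law no longer involves the messages, so these can be averaged first with the outputs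
  -- held fixed.
  rw [lintegral_lintegral_swap hW.ennreal_ofReal.aemeasurable]
  calc _ ≤ ∫⁻ _, 2 ∂(Measure.pi fun _ : Fin n => mixLaw g p) :=
        lintegral_mono fun v => lintegral_decodeWeight_le hR c hjk hjl hlk v
    _ = 2 := by simp

/-! ### The expected log-likelihood ratio -/

theorem measurePreserving_noise (hR : ∀ j k, 0 ≤ R j k) (i : Fin n) :
    MeasurePreserving (fun (ω : Sample n R) u => ω.2.1 u i) (law n R) gaussianVec := by
  have := nonempty_messages (n := n) hR
  have : IsProbabilityMeasure (uniformOn (Set.univ : Set (Messages n R))) :=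
    isProbabilityMeasure_uniformOn Set.finite_univ Set.univ_nonempty
  unfold law
  exact (measurePreserving_eval (fun _ : Fin n => gaussianVec) i).comp
    ((measurePreserving_swap_pi (ι := Fin 3) (κ := Fin n) (gaussianReal 0 1)).comp
      (measurePreserving_fst.comp measurePreserving_snd))

/-- The reflection of the users' noise at time `i`. -/
def flipNoise (i : Fin n) (ω : Sample n R) : Sample n R :=
  (ω.1, fun u t => (if t = i then fun x => -x else fun x => x) (ω.2.1 u t), ω.2.2)

theorem measurePreserving_flipNoise (i : Fin n) :
    MeasurePreserving (flipNoise (R := R) i) (law n R) (law n R) := by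
  have h1 : ∀ t : Fin n, MeasurePreserving
      (if t = i then fun x : ℝ => -x else fun x => x) (gaussianReal 0 1) (gaussianReal 0 1) := by
    intro t
    split_ifs
    · exact ⟨measurable_neg, by simpa using gaussianReal_map_neg (μ := 0) (v := 1)⟩
    · exact MeasurePreserving.id _
  have h2 : MeasurePreserving (fun (z : Fin 3 → Fin n → ℝ) u t =>
      (if t = i then fun x : ℝ => -x else fun x => x) (z u t))
      (Measure.pi fun _ => Measure.pi fun _ => gaussianReal 0 1)
      (Measure.pi fun _ => Measure.pi fun _ => gaussianReal 0 1) :=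
    measurePreserving_pi _ _ fun _ => measurePreserving_pi _ _ h1
  unfold law
  exact (MeasurePreserving.id _).prod (h2.prod (MeasurePreserving.id _))

/-- Reflecting the users' noise at time `i` preserves the law and, by causality, the relay input,
but negates the product. The integral equals its own negative, with no integrability needed. -/
theorem integral_relayInput_mul_noiseAlong (h : Fin 3 → ℝ) (c : Code n R) (g : Fin 3 → ℝ)
    (i : Fin n) : ∫ ω, relayInput h c i ω * noiseAlong g i ω ∂(law n R) = 0 := by
  have hmp := measurePreserving_flipNoise (R := R) i
  have hm : Measurable fun ω => relayInput h c i ω * noiseAlong g i ω :=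
    (measurable_relayInput h c i).mul (measurable_noiseAlong g i)
  have h1 : ∀ ω, relayInput h c i (flipNoise i ω) * noiseAlong g i (flipNoise i ω) =
      -(relayInput h c i ω * noiseAlong g i ω) := by
    intro ω
    have hX : relayInput h c i (flipNoise i ω) = relayInput h c i ω :=
      relayInput_congr h c ω.1 ω.2.2 i fun t ht j => by simp [ht.ne]
    have hZ : noiseAlong g i (flipNoise i ω) = -noiseAlong g i ω := by
      simp [noiseAlong, flipNoise]
    rw [hX, hZ, mul_neg]
  have h2 := integral_map hmp.measurable.aemeasurable (μ := law n R)
    (f := fun ω => relayInput h c i ω * noiseAlong g i ω) hm.aestronglyMeasurable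
  rw [hmp.map_eq] at h2
  simp_rw [h1] at h2
  rw [integral_neg] at h2
  linarith

theorem memLp_noiseAlong (hR : ∀ j k, 0 ≤ R j k) (g : Fin 3 → ℝ) (i : Fin n) :
    MemLp (noiseAlong (R := R) g i) 2 (law n R) :=
  (memLp_dot_gaussianVec g).comp_measurePreserving (measurePreserving_noise hR i)

theorem integral_noiseAlong_sq (hR : ∀ j k, 0 ≤ R j k) (g : Fin 3 → ℝ) (i : Fin n) :
    ∫ ω, noiseAlong g i ω ^ 2 ∂(law n R) = ∑ u, g u ^ 2 := by
  have hmp := measurePreserving_noise (n := n) hR i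
  have h := integral_map hmp.measurable.aemeasurable (μ := law n R)
    (f := fun z : Fin 3 → ℝ => (∑ u, g u * z u) ^ 2)
    ((measurable_mul_gaussian g).pow_const 2).aestronglyMeasurable
  rw [hmp.map_eq, integral_dot_sq_gaussianVec] at h
  exact h.symm

/-- `logRatio` is quadratic in input and noise, and the cross term has mean zero. The input power
enters with a negative coefficient, so power below `p` only increases the expectation. -/
theorem integrable_logRatio (hR : ∀ j k, 0 ≤ R j k) (h : Fin 3 → ℝ) (c : Code n R)
    (g : Fin 3 → ℝ) {p : ℝ} (hp : 0 ≤ p) (i : Fin n)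
    (hX : Integrable (fun ω => relayInput h c i ω ^ 2) (law n R)) :
    Integrable (fun ω => logRatio (∑ u, g u ^ 2) p (relayInput h c i ω) (noiseAlong g i ω))
        (law n R) ∧
      ∫ ω, logRatio (∑ u, g u ^ 2) p (relayInput h c i ω) (noiseAlong g i ω) ∂(law n R) =
        (∑ u, g u ^ 2) / (1 + (∑ u, g u ^ 2) * p) / 2 * (p - ∫ ω, relayInput h c i ω ^ 2 ∂(law n R))
          - Real.log (1 + (∑ u, g u ^ 2) * p) / 2 := by
  have := isProbabilityMeasure_law (n := n) hR
  set G := ∑ u, g u ^ 2 with hG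
  have hG0 : 0 ≤ G := by positivity
  have hs : 1 + G * p ≠ 0 := by positivity
  have hX2 : MemLp (relayInput h c i) 2 (law n R) :=
    (memLp_two_iff_integrable_sq (measurable_relayInput h c i).aestronglyMeasurable).2 hX
  have hZ2 := memLp_noiseAlong hR g i
  have hXZ : Integrable (fun ω => relayInput h c i ω * noiseAlong g i ω) (law n R) :=
    hX2.integrable_mul hZ2
  have hZ := hZ2.integrable_sq
  have heq : (fun ω => logRatio G p (relayInput h c i ω) (noiseAlong g i ω)) = fun ω =>
      ((p / (1 + G * p) * G ^ 2 - G) / 2 * relayInput h c i ω ^ 2 +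
        (p / (1 + G * p) * G - 1) * (relayInput h c i ω * noiseAlong g i ω)) +
        p / (1 + G * p) / 2 * noiseAlong g i ω ^ 2 + -(Real.log (1 + G * p) / 2) := by
    ext ω
    unfold logRatio
    ring
  have i1 := hX.const_mul ((p / (1 + G * p) * G ^ 2 - G) / 2)
  have i2 := hXZ.const_mul (p / (1 + G * p) * G - 1)
  have i3 := hZ.const_mul (p / (1 + G * p) / 2)
  have i4 : Integrable (fun _ : Sample n R => -(Real.log (1 + G * p) / 2)) (law n R) :=
    integrable_const _
  rw [heq]
  refine ⟨((i1.add i2).add i3).add i4, ?_⟩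
  rw [integral_add (by exact (i1.add i2).add i3) i4, integral_add (by exact i1.add i2) i3,
    integral_add i1 i2,
    integral_const_mul, integral_const_mul, integral_const_mul, integral_const,
    integral_relayInput_mul_noiseAlong, integral_noiseAlong_sq hR, ← hG]
  simp only [probReal_univ, smul_eq_mul]
  field_simp
  ring

/-- The expected log-likelihood ratio under the relay's power constraint. -/
theorem integral_totalLogRatio_ge (hR : ∀ j k, 0 ≤ R j k) (h : Fin 3 → ℝ) (c : Code n R)
    (g : Fin 3 → ℝ) {p : ℝ} (hp : 0 ≤ p) (hX : PowerConstraint (relayInput h c) p) :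
    Integrable (totalLogRatio h c g p) (law n R) ∧
      -(n * (Real.log (1 + (∑ u, g u ^ 2) * p) / 2)) ≤ ∫ ω, totalLogRatio h c g p ω ∂(law n R) := by
  have hi := fun i => integrable_logRatio hR h c g hp i (hX.1 i)
  unfold totalLogRatio
  refine ⟨integrable_finsetSum _ fun i _ => (hi i).1, ?_⟩
  rw [integral_finsetSum _ fun i _ => (hi i).1]
  simp_rw [fun i => (hi i).2]
  rw [Finset.sum_sub_distrib, ← Finset.mul_sum, Finset.sum_sub_distrib]
  simp only [Finset.sum_const, Finset.card_univ, Fintype.card_fin, nsmul_eq_mul]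
  have hsum : ∑ i, ∫ ω, relayInput h c i ω ^ 2 ∂(law n R) ≤ n * p := by
    rcases Nat.eq_zero_or_pos n with rfl | hn
    · simp
    · have hn' : (0 : ℝ) < n := by exact_mod_cast hn
      have := hX.2
      rwa [one_div, inv_mul_le_iff₀ hn'] at this
  have : 0 ≤ (∑ u, g u ^ 2) / (1 + (∑ u, g u ^ 2) * p) / 2 *
      (n * p - ∑ i, ∫ ω, relayInput h c i ω ^ 2 ∂(law n R)) :=
    mul_nonneg (by positivity) (sub_nonneg.2 hsum)
  linarith

/-! ### The bound at finite block length and its limit -/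

/-- A Fano-type bound for the number of triples of messages that users `j` and `l` can recover
together. -/
theorem log_numTriples_le (hR : ∀ j k, 0 ≤ R j k) (h : Fin 3 → ℝ) (c : Code n R) {p : ℝ}
    (hp : 0 ≤ p) (hX : PowerConstraint (relayInput h c) p) {j k l : Fin 3}
    (hjk : j ≠ k) (hjl : j ≠ l) (hlk : l ≠ k) :
    (1 - (c.errorProb h).toReal) * Real.log (numTriples n R hjk hjl hlk) ≤
      Real.log 2 + n * (Real.log (1 + (h j ^ 2 + h l ^ 2) * p) / 2) := by
  have := isProbabilityMeasure_law (n := n) hR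
  -- The output of user `k` is not used by the two decoders; zeroing its coefficient keeps `h k` out
  -- of the gain.
  set g : Fin 3 → ℝ := fun u => if u = k then 0 else h u with hg
  have hgG : ∑ u, g u ^ 2 = h j ^ 2 + h l ^ 2 := by
    have huniv : (Finset.univ : Finset (Fin 3)) = {j, k, l} := by
      ext x
      simp only [Finset.mem_univ, Finset.mem_insert, Finset.mem_singleton, true_iff]
      omega
    rw [huniv, Finset.sum_insert (by simp [hjk, hjl]), Finset.sum_pair hlk.symm]
    simp [hg, hjk, hlk]
  obtain ⟨hΛ, hΛ'⟩ := integral_totalLogRatio_ge hR h c g hp hX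
  rw [hgG] at hΛ'
  set N : ℕ := numTriples n R hjk hjl hlk with hN
  have hN1 : 1 ≤ N := by
    have hone : ∀ x y, 1 ≤ ⌊(2 : ℝ) ^ ((n : ℝ) * R x y)⌋₊ := fun x y =>
      Nat.one_le_floor_iff _ |>.2 (Real.one_le_rpow one_le_two (mul_nonneg n.cast_nonneg (hR x y)))
    exact Nat.mul_pos (Nat.mul_pos (hone _ _) (hone _ _)) (hone _ _)
  have hlogN : 0 ≤ Real.log N := Real.log_natCast_nonneg N
  set W : Sample n R → ℝ := fun ω => decodeWeight c hjk hjl hlk (ω.1, outputAlong h c g ω) with hW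
  set A : Set (Sample n R) := {ω | DecodesAt c j l ω.1 (outputAlong h c g ω)} with hA
  have hAm : MeasurableSet A :=
    (measurable_fst.prodMk (measurable_outputAlong h c g)) (measurableSet_decodesAt c j l)
  have hWA : ∀ ω, W ω = A.indicator (fun _ => (N : ℝ)) ω + 1 := fun ω => rfl
  have hW0 : ∀ ω, 0 ≤ W ω := fun ω => by
    rw [hWA]; exact add_nonneg (Set.indicator_nonneg (fun _ _ => N.cast_nonneg) _) zero_le_one
  have hWm : Measurable W := (measurable_const.indicator hAm).add measurable_const
  have hlint : ∫⁻ ω, ENNReal.ofReal (Real.exp (totalLogRatio h c g p ω) * W ω) ∂(law n R) ≤ 2 := by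
    simp_rw [fun ω => ENNReal.ofReal_mul (q := W ω) (Real.exp_nonneg (totalLogRatio h c g p ω))]
    exact lintegral_totalLogRatio_decodeWeight_le hR h c g hp hjk hjl hlk
  have hEm : Measurable fun ω => Real.exp (totalLogRatio h c g p ω) * W ω :=
    (Real.measurable_exp.comp (measurable_totalLogRatio h c g p)).mul hWm
  have hE0 : ∀ ω, 0 ≤ Real.exp (totalLogRatio h c g p ω) * W ω := fun ω =>
    mul_nonneg (Real.exp_nonneg _) (hW0 ω)
  have hEi : Integrable (fun ω => Real.exp (totalLogRatio h c g p ω) * W ω) (law n R) :=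
    ⟨hEm.aestronglyMeasurable, by
      rw [hasFiniteIntegral_iff_ofReal (Filter.Eventually.of_forall hE0)]
      exact hlint.trans_lt (by simp)⟩
  have hE2 : ∫ ω, Real.exp (totalLogRatio h c g p ω) * W ω ∂(law n R) ≤ 2 := by
    rw [integral_eq_lintegral_of_nonneg_ae (Filter.Eventually.of_forall hE0)
      hEm.aestronglyMeasurable]
    exact ENNReal.toReal_le_of_le_ofReal zero_le_two (by simpa using hlint)
  -- The tangent line of `exp` at `log 2`, where the constants are sharp: the mean of the right side
  -- is at most `log 2`. The `+ 1` in the weight covers the points outside `A`.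
  have hpt : ∀ ω, totalLogRatio h c g p ω + A.indicator (fun _ => Real.log N) ω ≤
      Real.exp (totalLogRatio h c g p ω) * W ω / 2 + (Real.log 2 - 1) := by
    intro ω
    have hexp : ∀ x : ℝ, x - Real.log 2 + 1 ≤ Real.exp x / 2 := fun x => by
      have := Real.add_one_le_exp (x - Real.log 2)
      rwa [Real.exp_sub, Real.exp_log two_pos] at this
    rw [hWA]
    by_cases hω : ω ∈ A
    · rw [Set.indicator_of_mem hω, Set.indicator_of_mem hω]
      have h1 := hexp (totalLogRatio h c g p ω + Real.log N)
      rw [Real.exp_add, Real.exp_log (by exact_mod_cast hN1)] at h1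
      have := Real.exp_pos (totalLogRatio h c g p ω)
      linarith
    · rw [Set.indicator_of_notMem hω, Set.indicator_of_notMem hω]
      have h1 := hexp (totalLogRatio h c g p ω)
      linarith
  have hAi : Integrable (A.indicator fun _ => Real.log N) (law n R) :=
    (integrable_const _).indicator hAm
  have hint := integral_mono (hΛ.add hAi) ((hEi.div_const 2).add (integrable_const _)) hpt
  rw [integral_add' hΛ hAi, integral_indicator_const _ hAm,
    integral_add' (hEi.div_const 2) (integrable_const _), integral_div, integral_const,
    probReal_univ, one_smul, smul_eq_mul] at hint
  have herr : 1 - (c.errorProb h).toReal ≤ (law n R).real A := by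
    have hcompl : (law n R).real Aᶜ ≤ (c.errorProb h).toReal := by
      refine ENNReal.toReal_mono (measure_ne_top _ _) (measure_mono fun ω hω => ?_)
      by_contra hcon
      refine hω ?_
      simp only [Set.mem_ofPred_eq, not_exists, not_not] at hcon
      have hout : ∀ u, u ≠ k → ∀ i, outputAlong h c g ω i u = userOutput h c u i ω := by
        intro u hu i
        rw [userOutput_eq]
        simp only [outputAlong, hg, if_neg hu]
        ring
      refine ⟨?_, ?_⟩
      · simp_rw [hout j hjk]; exact hcon j
      · simp_rw [hout l hlk]; exact hcon l
    rw [probReal_compl_eq_one_sub hAm] at hcompl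
    linarith
  have := mul_le_mul_of_nonneg_right herr hlogN
  linarith

theorem log_numTriples_ge (hR : ∀ j k, 0 ≤ R j k) {j k l : Fin 3}
    (hjk : j ≠ k) (hjl : j ≠ l) (hlk : l ≠ k) :
    (n * (R k ⟨j, hjk⟩ + R l ⟨j, hjl⟩ + R k ⟨l, hlk⟩) - 3) * Real.log 2 ≤
      Real.log (numTriples n R hjk hjl hlk) := by
  have hone : ∀ x y, 0 < (⌊(2 : ℝ) ^ ((n : ℝ) * R x y)⌋₊ : ℝ) ∧
      (n * R x y - 1) * Real.log 2 ≤ Real.log ⌊(2 : ℝ) ^ ((n : ℝ) * R x y)⌋₊ := by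
    intro x y
    have h1 : (1 : ℝ) ≤ (2 : ℝ) ^ ((n : ℝ) * R x y) :=
      Real.one_le_rpow one_le_two (mul_nonneg n.cast_nonneg (hR x y))
    have h2 : 1 ≤ ⌊(2 : ℝ) ^ ((n : ℝ) * R x y)⌋₊ := Nat.one_le_floor_iff _ |>.2 h1
    have h2' : (1 : ℝ) ≤ ⌊(2 : ℝ) ^ ((n : ℝ) * R x y)⌋₊ := by exact_mod_cast h2
    refine ⟨by linarith, ?_⟩
    -- Rounding down a number that is at least one loses at most a factor two, so the three floors
    -- cost at most three bits.
    have h3 : (2 : ℝ) ^ ((n : ℝ) * R x y - 1) ≤ ⌊(2 : ℝ) ^ ((n : ℝ) * R x y)⌋₊ := by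
      rw [Real.rpow_sub_one two_ne_zero]
      have := Nat.lt_floor_add_one ((2 : ℝ) ^ ((n : ℝ) * R x y))
      linarith
    have h4 := Real.log_le_log (by positivity) h3
    rwa [Real.log_rpow two_pos] at h4
  unfold numTriples
  push_cast
  obtain ⟨p1, q1⟩ := hone k ⟨j, hjk⟩
  obtain ⟨p2, q2⟩ := hone l ⟨j, hjl⟩
  obtain ⟨p3, q3⟩ := hone k ⟨l, hlk⟩
  rw [Real.log_mul (by positivity) p3.ne', Real.log_mul p1.ne' p2.ne']
  linarith

end YChannel

theorem mainTheorem7 (h : Fin 3 → ℝ) (P Pr : ℝ) (R : YChannel.Rates)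
    (hR : R ∈ YChannel.capacityRegion h P Pr) (j k l : Fin 3)
    (hjk : j ≠ k) (hjl : j ≠ l) (hlk : l ≠ k) :
    R k ⟨j, hjk⟩ + R l ⟨j, hjl⟩ + R k ⟨l, hlk⟩ ≤
      YChannel.gaussianCap (h j ^ 2 * Pr + h l ^ 2 * Pr) := by
  obtain ⟨hR0, c, hc, herr⟩ := hR
  -- The power constraint of the code of block length one already forces this sign.
  have hPr : 0 ≤ Pr := le_trans (mul_nonneg (by positivity)
    (Finset.sum_nonneg fun i _ => MeasureTheory.integral_nonneg fun ω => sq_nonneg _)) (hc 1).2.2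
  have hl2 : 0 < Real.log 2 := Real.log_pos one_lt_two
  set S := R k ⟨j, hjk⟩ + R l ⟨j, hjl⟩ + R k ⟨l, hlk⟩ with hS
  set K := Real.log (1 + (h j ^ 2 + h l ^ 2) * Pr) / 2 with hK
  have he : Filter.Tendsto (fun n => ((c n).errorProb h).toReal) Filter.atTop (nhds 0) :=
    (ENNReal.tendsto_toReal ENNReal.zero_ne_top).comp herr
  have hinv : Filter.Tendsto (fun n : ℕ => (1 : ℝ) / n) Filter.atTop (nhds 0) :=
    tendsto_one_div_atTop_nhds_zero_nat
  have hlhs : Filter.Tendsto (fun n : ℕ => (1 - ((c n).errorProb h).toReal) *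
      ((S - 3 * ((1 : ℝ) / n)) * Real.log 2)) Filter.atTop
      (nhds ((1 - 0) * ((S - 3 * 0) * Real.log 2))) :=
    (he.const_sub 1).mul (((hinv.const_mul 3).const_sub S).mul_const _)
  have hrhs : Filter.Tendsto (fun n : ℕ => Real.log 2 * ((1 : ℝ) / n) + K) Filter.atTop
      (nhds (Real.log 2 * 0 + K)) := (hinv.const_mul _).add_const _
  have hle : S * Real.log 2 ≤ K := by
    have := le_of_tendsto_of_tendsto hlhs hrhs ?_
    · linarith
    filter_upwards [Filter.eventually_gt_atTop 0] with n hn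
    have hn' : (0 : ℝ) < n := by exact_mod_cast hn
    have hp := YChannel.isProbabilityMeasure_law (n := n) hR0
    have hε : 0 ≤ 1 - ((c n).errorProb h).toReal := by
      have : ((c n).errorProb h).toReal ≤ 1 := MeasureTheory.measureReal_le_one
      linarith
    have h1 := YChannel.log_numTriples_le hR0 h (c n) hPr (hc n).2 hjk hjl hlk
    have h2 := mul_le_mul_of_nonneg_left
      (YChannel.log_numTriples_ge (n := n) hR0 hjk hjl hlk) hε
    have h3 := (h2.trans h1)
    have h4 := mul_le_mul_of_nonneg_left h3 (one_div_pos.2 hn').le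
    calc _ = 1 / (n : ℝ) * ((1 - ((c n).errorProb h).toReal) * ((n * S - 3) * Real.log 2)) := by
          field_simp
      _ ≤ _ := h4
      _ = _ := by rw [hK]; field_simp
  rw [YChannel.gaussianCap, Real.logb, ← add_mul, ← mul_div_assoc, le_div_iff₀ hl2]
  linarith
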